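/- **Theorem 4.1.** Let $\alpha^+,\lambda^+,\alpha^-,\lambda^->0$, and consider the bilateral Gamma distribution with these parameters, that is, the law of $X-Y$ where $X$ and $Y$ are independent, $X\sim\Gamma(\alpha^+,\lambda^+)$ and $Y\sim\Gamma(\alpha^-,\lambda^-)$ (shape $\alpha^\pm$, rate $\lambda^\pm$). Let $N\in\mathbb{N}_0$ be the unique nonnegative integer with $N<\alpha^++\alpha^-\le N+1$. Let $g_{\alpha,\lambda}(y)=\frac{\lambda^\alpha}{\Gamma(\alpha)}y^{\alpha-1}e^{-\lambda y}\mathbf{1}_{(0,\infty)}(y)$ be the Gamma density and put $$f(x)=\int_{\mathbb{R}} g_{\alpha^+,\lambda^+}(x+y)\,g_{\alpha^-,\lambda^-}(y)\,dy,\qquad x\in\mathbb{R},$$ with $f(0):=0$ if the integral diverges at $x=0$ (which happens exactly when $\alpha^++\alpha^-\le 1$). Then $f$ is a Lebesgue density of the bilateral Gamma distribution, and 1. $f\in C^N(\mathbb{R}\setminus\{0\})$; 2. if $N\ge 1$, then $f\in C^{N-1}(\mathbb{R})$; 3. $f\notin C^N(\mathbb{R})$; moreover, no version of the density (no nonnegative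 measurable function that is a Lebesgue density of the distribution) belongs to $C^N(\mathbb{R})$. -/

import Mathlib

open MeasureTheory ProbabilityTheory

noncomputable section

/-- The bilateral Gamma distribution: the law of `X - Y`, where `X` and `Y` are independent,
`X` is Gamma distributed with shape `ap` and rate `lp`, and `Y` is Gamma distributed with
shape `am` and rate `lm`. -/
def bilateralGammaMeasure (ap lp am lm : ℝ) : Measure ℝ :=
  Measure.map (fun p : ℝ × ℝ => p.1 - p.2) ((gammaMeasure ap lp).prod (gammaMeasure am lm))

/-- `g` is a (version of the) Lebesgue density of the bilateral Gamma distribution. -/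
def IsBilateralGammaDensity (ap lp am lm : ℝ) (g : ℝ → ℝ) : Prop :=
  Measurable g ∧ (∀ x, 0 ≤ g x) ∧
    bilateralGammaMeasure ap lp am lm = volume.withDensity (fun x => ENNReal.ofReal (g x))

/-- The bilateral Gamma density, as the convolution of the density of `X` with the density of
`-Y`. The integral converges for all real `x`, except for `x = 0` when `ap + am ≤ 1`, where
the density has a pole. -/
def bilateralGammaPDF (ap lp am lm : ℝ) (x : ℝ) : ℝ :=
  ∫ y, gammaPDFReal ap lp (x + y) * gammaPDFReal am lm y

end

/-! Write `f_{a,b}` for the density with shapes `a`, `b` and rates `l`, `m`. The Gamma density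
satisfies `g_{a+1}' = l (g_a - g_{a+1})`, and convolution transfers this to `f_{a+1,b}' = l (f_{a,b}
- f_{a+1,b})` wherever `f_{a,b}` is continuous (`hasDerivAt_bilateralGammaPDF_add_one`). Each unit
of shape is thus worth one derivative; reflection `x ↦ -x` exchanges the roles of `a` and `b`.

Off the origin, `mul_bilateralGammaPDF` writes `x f_{a,b}` through densities with one shape raised,
so smoothness there follows by induction. On the whole line, `f_{a,b}` is continuous once `1 < a +
b`, and the recurrence adds the derivatives.

Sharpness goes down the same ladder: `g + g'/l` turns a `C^(n+1)` version for `(a, b)` into a `C^n`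
version for `(a - 1, b)`. The descent ends either at `a + b ≤ 1`, where there is a logarithmic pole,
or at `a, b ≤ 1 < a + b`. There a derivative `d` at `0` would satisfy `m f(0) ≤ d ≤ -l f(0)`, which
is impossible since `f(0) > 0`. -/

open Set Filter Topology

/-! ### Gamma densities: bounds, recurrences, products. -/

lemma gammaPDFReal_of_nonneg {a r x : ℝ} (hx : 0 ≤ x) :
    gammaPDFReal a r x = r ^ a / Real.Gamma a * x ^ (a - 1) * Real.exp (-(r * x)) := by
  simp [gammaPDFReal, hx]

lemma gammaPDFReal_of_neg {a r x : ℝ} (hx : x < 0) : gammaPDFReal a r x = 0 := by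
  simp [gammaPDFReal, not_le.mpr hx]

lemma integrable_gammaPDFReal {a r : ℝ} (ha : 0 < a) (hr : 0 < r) :
    Integrable (gammaPDFReal a r) := by
  refine ⟨(stronglyMeasurable_gammaPDFReal a r).aestronglyMeasurable, ?_⟩
  rw [hasFiniteIntegral_iff_ofReal (ae_of_all _ (gammaPDFReal_nonneg ha hr))]
  have := lintegral_gammaPDF_eq_one ha hr
  simp only [gammaPDF] at this
  rw [this]
  exact ENNReal.one_lt_top

lemma continuousAt_gammaPDFReal {a r x : ℝ} (hx : x ≠ 0) : ContinuousAt (gammaPDFReal a r) x := by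
  rcases lt_or_gt_of_ne hx with h | h
  · refine (continuousAt_const (y := (0 : ℝ))).congr ?_
    filter_upwards [Iio_mem_nhds h] with y hy
    exact (gammaPDFReal_of_neg hy).symm
  · have : ContinuousAt
        (fun x : ℝ => r ^ a / Real.Gamma a * x ^ (a - 1) * Real.exp (-(r * x))) x :=
      (continuousAt_const.mul (Real.continuousAt_rpow_const _ _ (Or.inl hx))).mul
        (by fun_prop)
    refine this.congr ?_
    filter_upwards [Ioi_mem_nhds h] with y hy
    exact (gammaPDFReal_of_nonneg (le_of_lt hy)).symm

/-- The Gamma density is bounded away from its possible pole at the origin. -/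
lemma exists_gammaPDFReal_le_of_le {a r δ : ℝ} (hr : 0 < r) (hδ : 0 ≤ δ) (h : 0 < δ ∨ 1 ≤ a) :
    ∃ M, ∀ z, δ ≤ z → gammaPDFReal a r z ≤ M := by
  set G : ℝ → ℝ := fun x => r ^ a / Real.Gamma a * x ^ (a - 1) * Real.exp (-(r * x)) with hG
  have hc : ContinuousOn G (Ici δ) := by
    intro z hz
    refine ContinuousAt.continuousWithinAt ?_
    refine (continuousAt_const.mul (Real.continuousAt_rpow_const _ _ ?_)).mul (by fun_prop)
    rcases h with h | h
    · exact Or.inl (h.trans_le hz).ne'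
    · exact Or.inr (by linarith)
  have ht : Tendsto G atTop (𝓝 0) := by
    have := (tendsto_rpow_mul_exp_neg_mul_atTop_nhds_zero (a - 1) r hr).const_mul
      (r ^ a / Real.Gamma a)
    rw [mul_zero] at this
    refine this.congr fun x => ?_
    simp only [hG, neg_mul, mul_assoc]
  obtain ⟨R, hR⟩ := eventually_atTop.1 (ht.eventually (gt_mem_nhds zero_lt_one))
  obtain ⟨M, hM⟩ := (isCompact_Icc (a := δ) (b := R)).bddAbove_image (hc.mono fun x hx => hx.1)
  refine ⟨max M 1, fun z hz => ?_⟩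
  rw [gammaPDFReal_of_nonneg (hδ.trans hz)]
  rcases le_total z R with hzR | hzR
  · exact le_max_of_le_left (hM ⟨z, ⟨hz, hzR⟩, rfl⟩)
  · exact le_max_of_le_right (hR z hzR).le

lemma gammaPDFReal_antitoneOn {a r : ℝ} (ha : 0 < a) (hr : 0 < r) (ha1 : a ≤ 1) :
    AntitoneOn (gammaPDFReal a r) (Ioi 0) := by
  intro y hy z hz hyz
  rw [mem_Ioi] at hy hz
  rw [gammaPDFReal_of_nonneg hy.le, gammaPDFReal_of_nonneg hz.le]
  have := Real.Gamma_pos_of_pos ha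
  have h1 : z ^ (a - 1) ≤ y ^ (a - 1) := Real.rpow_le_rpow_of_nonpos hy hyz (by linarith)
  gcongr

lemma mul_gammaPDFReal {a r : ℝ} (ha : 0 < a) (hr : 0 < r) (z : ℝ) :
    z * gammaPDFReal a r z = a / r * gammaPDFReal (a + 1) r z := by
  rcases lt_trichotomy z 0 with h | h | h
  · simp [gammaPDFReal_of_neg h]
  · subst h
    simp [gammaPDFReal_of_nonneg le_rfl, Real.zero_rpow ha.ne']
  · rw [gammaPDFReal_of_nonneg h.le, gammaPDFReal_of_nonneg h.le, Real.Gamma_add_one ha.ne',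
      Real.rpow_add_one hr.ne', add_sub_cancel_right]
    have : z ^ a = z ^ (a - 1) * z := by
      rw [← Real.rpow_add_one h.ne']; simp
    rw [this]
    have := (Real.Gamma_pos_of_pos ha).ne'
    field_simp

lemma hasDerivAt_gammaPDFReal_add_one {a r z : ℝ} (ha : 0 < a) (hr : 0 < r) (hz : z ≠ 0) :
    HasDerivAt (gammaPDFReal (a + 1) r)
      (r * (gammaPDFReal a r z - gammaPDFReal (a + 1) r z)) z := by
  rcases lt_or_gt_of_ne hz with h | h
  · rw [gammaPDFReal_of_neg h, gammaPDFReal_of_neg h, sub_zero, mul_zero]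
    refine (hasDerivAt_const z (0 : ℝ)).congr_of_eventuallyEq ?_
    filter_upwards [Iio_mem_nhds h] with y hy
    exact gammaPDFReal_of_neg hy
  · have h1 : HasDerivAt
        (fun x : ℝ => r ^ (a + 1) / Real.Gamma (a + 1) * x ^ a * Real.exp (-(r * x)))
        (r ^ (a + 1) / Real.Gamma (a + 1) * (a * z ^ (a - 1)) * Real.exp (-(r * z)) +
          r ^ (a + 1) / Real.Gamma (a + 1) * z ^ a * (Real.exp (-(r * z)) * (-(r * 1)))) z :=
      ((Real.hasDerivAt_rpow_const (Or.inl hz)).const_mul _).mul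
        (((hasDerivAt_id z).const_mul r).neg.exp)
    have h2 := h1.congr_of_eventuallyEq (f₁ := gammaPDFReal (a + 1) r) (by
      filter_upwards [Ioi_mem_nhds h] with y hy
      rw [gammaPDFReal_of_nonneg (le_of_lt hy), add_sub_cancel_right])
    refine h2.congr_deriv ?_
    rw [gammaPDFReal_of_nonneg h.le, gammaPDFReal_of_nonneg h.le, add_sub_cancel_right,
      Real.Gamma_add_one ha.ne', Real.rpow_add_one hr.ne']
    have := (Real.Gamma_pos_of_pos ha).ne'
    field_simp
    ring

lemma continuous_gammaPDFReal_add_one {a r : ℝ} (ha : 0 < a) :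
    Continuous (gammaPDFReal (a + 1) r) := by
  have : gammaPDFReal (a + 1) r =
      fun x => if 0 ≤ x then r ^ (a + 1) / Real.Gamma (a + 1) * x ^ a * Real.exp (-(r * x))
        else 0 := by
    ext x; simp [gammaPDFReal]
  rw [this]
  refine Continuous.if_le ?_ continuous_const continuous_const continuous_id ?_
  · exact (continuous_const.mul (Real.continuous_rpow_const ha.le)).mul (by fun_prop)
  · rintro x rfl
    simp [Real.zero_rpow ha.ne']

/-- The derivative formula may fail at `0`, but continuity of the density of shape `a + 1 > 1` lets
the fundamental theorem ignore that point. -/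
lemma integral_gammaPDFReal_sub {a r : ℝ} (ha : 0 < a) (hr : 0 < r) (u v : ℝ) :
    ∫ z in u..v, r * (gammaPDFReal a r z - gammaPDFReal (a + 1) r z) =
      gammaPDFReal (a + 1) r v - gammaPDFReal (a + 1) r u := by
  refine integral_eq_of_hasDerivAt_off_countable (s := {0}) _ _ (countable_singleton _)
    (continuous_gammaPDFReal_add_one ha).continuousOn
    (fun x hx => hasDerivAt_gammaPDFReal_add_one ha hr hx.2) ?_
  exact (((integrable_gammaPDFReal ha hr).sub
    (integrable_gammaPDFReal (by linarith) hr)).const_mul r).intervalIntegrable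

/-- The product of two Gamma densities is integrable when the exponents add up to more than one. -/
lemma integrable_gammaPDFReal_mul {a l b m : ℝ} (hl : 0 < l) (hm : 0 < m) (hs : 1 < a + b) :
    Integrable fun y => gammaPDFReal a l y * gammaPDFReal b m y := by
  have h := (integrable_gammaPDFReal (a := a + b - 1) (r := l + m) (by linarith)
    (by linarith)).const_mul (l ^ a / Real.Gamma a * (m ^ b / Real.Gamma b) /
      ((l + m) ^ (a + b - 1) / Real.Gamma (a + b - 1)))
  refine h.congr ?_
  filter_upwards [compl_mem_ae_iff.2 (measure_singleton (0 : ℝ))] with y hy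
  rcases lt_or_gt_of_ne hy with h | h
  · simp [gammaPDFReal_of_neg h]
  · simp only [gammaPDFReal_of_nonneg h.le]
    have e1 : y ^ (a + b - 1 - 1) = y ^ (a - 1) * y ^ (b - 1) := by
      rw [← Real.rpow_add h]; ring_nf
    have e2 : Real.exp (-((l + m) * y)) = Real.exp (-(l * y)) * Real.exp (-(m * y)) := by
      rw [← Real.exp_add]; ring_nf
    have h3 := (Real.Gamma_pos_of_pos (show 0 < a + b - 1 by linarith)).ne'
    have h4 := (Real.rpow_pos_of_pos (show 0 < l + m by linarith) (a + b - 1)).ne'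
    rw [e1, e2]
    field_simp

/-! ### The convolution: reflection, integrability, continuity. -/

lemma bilateralGammaPDF_neg (a l b m x : ℝ) :
    bilateralGammaPDF a l b m (-x) = bilateralGammaPDF b m a l x := by
  unfold bilateralGammaPDF
  rw [← integral_add_right_eq_self _ x]
  refine integral_congr_ae (ae_of_all _ fun y => ?_)
  simp only [add_comm y x, neg_add_cancel_left, mul_comm]

lemma bilateralGammaPDF_nonneg {a l b m : ℝ} (ha : 0 < a) (hl : 0 < l) (hb : 0 < b) (hm : 0 < m)
    (x : ℝ) : 0 ≤ bilateralGammaPDF a l b m x :=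
  integral_nonneg fun _ => mul_nonneg (gammaPDFReal_nonneg ha hl _) (gammaPDFReal_nonneg hb hm _)

lemma measurable_bilateralGammaPDF (a l b m : ℝ) : Measurable (bilateralGammaPDF a l b m) := by
  have : StronglyMeasurable
      (fun p : ℝ × ℝ => gammaPDFReal a l (p.1 + p.2) * gammaPDFReal b m p.2) :=
    Measurable.stronglyMeasurable (by fun_prop)
  exact this.integral_prod_right'.measurable

lemma measurable_bilateralGammaPDF_integrand (a l b m x : ℝ) :
    Measurable fun y => gammaPDFReal a l (x + y) * gammaPDFReal b m y := by
  fun_prop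

/-- Off the origin, the integrand of the bilateral Gamma density is locally uniformly dominated
by the Gamma density of one of the summands. -/
lemma bilateralGammaPDF_integrand_le {a l b m M δ : ℝ} (hb : 0 < b) (hm : 0 < m)
    (hM : ∀ z, δ ≤ z → gammaPDFReal a l z ≤ M) {x : ℝ} (hx : δ ≤ x) (y : ℝ) :
    gammaPDFReal a l (x + y) * gammaPDFReal b m y ≤ M * gammaPDFReal b m y := by
  rcases lt_or_ge y 0 with h | h
  · simp [gammaPDFReal_of_neg h]
  · exact mul_le_mul_of_nonneg_right (hM _ (by linarith)) (gammaPDFReal_nonneg hb hm y)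

lemma ae_continuousAt_bilateralGammaPDF_integrand (a l b m x : ℝ) :
    ∀ᵐ y, ContinuousAt (fun x => gammaPDFReal a l (x + y) * gammaPDFReal b m y) x := by
  filter_upwards [compl_mem_ae_iff.2 (measure_singleton (-x))] with y hy
  have hxy : x + y ≠ 0 := fun h => hy (by simp only [mem_singleton_iff]; linarith)
  have h1 : ContinuousAt (gammaPDFReal a l) (x + y) := continuousAt_gammaPDFReal hxy
  exact (h1.comp (f := fun x => x + y) (by fun_prop)).mul continuousAt_const

lemma integrable_bilateralGammaPDF_integrand_of_pos {a l b m x : ℝ} (ha : 0 < a) (hl : 0 < l)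
    (hb : 0 < b) (hm : 0 < m) (hx : 0 < x) :
    Integrable fun y => gammaPDFReal a l (x + y) * gammaPDFReal b m y := by
  obtain ⟨M, hM⟩ := exists_gammaPDFReal_le_of_le (a := a) hl hx.le (Or.inl hx)
  refine ((integrable_gammaPDFReal hb hm).const_mul M).mono'
    (measurable_bilateralGammaPDF_integrand a l b m x).aestronglyMeasurable
    (ae_of_all _ fun y => ?_)
  rw [Real.norm_of_nonneg (mul_nonneg (gammaPDFReal_nonneg ha hl _) (gammaPDFReal_nonneg hb hm _))]
  exact bilateralGammaPDF_integrand_le hb hm hM le_rfl y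

lemma integrable_bilateralGammaPDF_integrand {a l b m x : ℝ} (ha : 0 < a) (hl : 0 < l)
    (hb : 0 < b) (hm : 0 < m) (hx : x ≠ 0) :
    Integrable fun y => gammaPDFReal a l (x + y) * gammaPDFReal b m y := by
  rcases lt_or_gt_of_ne hx with h | h
  · have := (integrable_bilateralGammaPDF_integrand_of_pos hb hm ha hl
      (neg_pos.2 h)).comp_add_right x
    refine this.congr (ae_of_all _ fun y => ?_)
    simp only [add_comm y x, neg_add_cancel_left, mul_comm]
  · exact integrable_bilateralGammaPDF_integrand_of_pos ha hl hb hm h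

lemma continuousAt_bilateralGammaPDF_of_pos {a l b m x : ℝ} (ha : 0 < a) (hl : 0 < l)
    (hb : 0 < b) (hm : 0 < m) (hx : 0 < x) : ContinuousAt (bilateralGammaPDF a l b m) x := by
  obtain ⟨M, hM⟩ := exists_gammaPDFReal_le_of_le (a := a) hl (half_pos hx).le (Or.inl (half_pos hx))
  refine continuousAt_of_dominated (bound := fun y => M * gammaPDFReal b m y)
    (Eventually.of_forall fun x =>
      (measurable_bilateralGammaPDF_integrand a l b m x).aestronglyMeasurable) ?_
    ((integrable_gammaPDFReal hb hm).const_mul M)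
    (ae_continuousAt_bilateralGammaPDF_integrand a l b m x)
  filter_upwards [Ici_mem_nhds (half_lt_self hx)] with z hz
  refine ae_of_all _ fun y => ?_
  rw [Real.norm_of_nonneg (mul_nonneg (gammaPDFReal_nonneg ha hl _) (gammaPDFReal_nonneg hb hm _))]
  exact bilateralGammaPDF_integrand_le hb hm hM hz y

lemma continuousAt_bilateralGammaPDF_of_ne {a l b m x : ℝ} (ha : 0 < a) (hl : 0 < l)
    (hb : 0 < b) (hm : 0 < m) (hx : x ≠ 0) : ContinuousAt (bilateralGammaPDF a l b m) x := by
  rcases lt_or_gt_of_ne hx with h | h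
  · have h1 : ContinuousAt (bilateralGammaPDF b m a l) (-x) :=
      continuousAt_bilateralGammaPDF_of_pos hb hm ha hl (neg_pos.2 h)
    refine (h1.comp (f := fun x => -x) continuousAt_neg).congr (Eventually.of_forall fun y => ?_)
    exact bilateralGammaPDF_neg b m a l y
  · exact continuousAt_bilateralGammaPDF_of_pos ha hl hb hm h

lemma continuousWithinAt_bilateralGammaPDF_zero {a l b m : ℝ} (ha : 0 < a) (hl : 0 < l)
    (hb : 0 < b) (hm : 0 < m) (hs : 1 < a + b) :
    ContinuousWithinAt (bilateralGammaPDF a l b m) (Ici 0) 0 := by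
  have key : ∃ bound : ℝ → ℝ, Integrable bound ∧ ∀ x, 0 ≤ x → ∀ᵐ y,
      gammaPDFReal a l (x + y) * gammaPDFReal b m y ≤ bound y := by
    -- For `1 ≤ a` the first factor is bounded. For `a ≤ 1` it is decreasing, so the integrand at `x
    -- = 0` dominates, and it is integrable because `1 < a + b`.
    rcases le_total 1 a with h1 | h1
    · obtain ⟨M, hM⟩ := exists_gammaPDFReal_le_of_le (a := a) hl le_rfl (Or.inr h1)
      exact ⟨_, (integrable_gammaPDFReal hb hm).const_mul M,
        fun x hx => ae_of_all _ (bilateralGammaPDF_integrand_le hb hm hM hx)⟩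
    · refine ⟨_, integrable_gammaPDFReal_mul hl hm hs, fun x hx => ?_⟩
      filter_upwards [compl_mem_ae_iff.2 (measure_singleton (0 : ℝ))] with y hy
      rcases lt_or_gt_of_ne hy with h | h
      · simp [gammaPDFReal_of_neg h]
      · exact mul_le_mul_of_nonneg_right
          (gammaPDFReal_antitoneOn ha hl h1 h (mem_Ioi.2 (by linarith))
            (by linarith)) (gammaPDFReal_nonneg hb hm y)
  obtain ⟨bound, hbi, hb'⟩ := key
  refine continuousWithinAt_of_dominated (bound := bound)
    (Eventually.of_forall fun x =>
      (measurable_bilateralGammaPDF_integrand a l b m x).aestronglyMeasurable) ?_ hbi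
    ((ae_continuousAt_bilateralGammaPDF_integrand a l b m 0).mono
      fun y hy => hy.continuousWithinAt)
  filter_upwards [self_mem_nhdsWithin] with x hx
  filter_upwards [hb' x hx] with y hy
  rwa [Real.norm_of_nonneg
    (mul_nonneg (gammaPDFReal_nonneg ha hl _) (gammaPDFReal_nonneg hb hm _))]

lemma continuous_bilateralGammaPDF {a l b m : ℝ} (ha : 0 < a) (hl : 0 < l)
    (hb : 0 < b) (hm : 0 < m) (hs : 1 < a + b) : Continuous (bilateralGammaPDF a l b m) := by
  refine continuous_iff_continuousAt.2 fun x => ?_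
  rcases eq_or_ne x 0 with rfl | hx
  · refine continuousAt_iff_continuous_left_right.2
      ⟨?_, continuousWithinAt_bilateralGammaPDF_zero ha hl hb hm hs⟩
    have h1 : ContinuousWithinAt (bilateralGammaPDF b m a l) (Ici 0) (-0) := by
      rw [neg_zero]
      exact continuousWithinAt_bilateralGammaPDF_zero hb hm ha hl (by linarith)
    refine (h1.comp (f := fun x : ℝ => -x) (s := Iic 0) continuousWithinAt_neg
      fun y hy => ?_).congr (fun y _ => ?_) ?_
    · simpa using hy
    · exact (bilateralGammaPDF_neg b m a l y).symm
    · exact (bilateralGammaPDF_neg b m a l 0).symm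
  · exact continuousAt_bilateralGammaPDF_of_ne ha hl hb hm hx

/-! ### Recurrences in the shape parameters. -/

lemma integrable_prod_bilateralGammaPDF_integrand {a l b m : ℝ} (ha : 0 < a) (hl : 0 < l)
    (hb : 0 < b) (hm : 0 < m) :
    Integrable (fun p : ℝ × ℝ => gammaPDFReal a l (p.1 + p.2) * gammaPDFReal b m p.2)
      (volume.prod volume) := by
  have h := ((integrable_gammaPDFReal hb hm).mul_prod (integrable_gammaPDFReal ha hl))
  have h2 :=
    (measurePreserving_prod_add_swap (volume : Measure ℝ) volume).integrable_comp_of_integrable h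
  refine h2.congr (ae_of_all _ fun p => ?_)
  simp only [Function.comp, mul_comm, add_comm]

lemma integrable_bilateralGammaPDF {a l b m : ℝ} (ha : 0 < a) (hl : 0 < l)
    (hb : 0 < b) (hm : 0 < m) : Integrable (bilateralGammaPDF a l b m) :=
  (integrable_prod_bilateralGammaPDF_integrand ha hl hb hm).integral_prod_left

lemma integrable_bilateralGammaPDF_integrand_of_one_le {a l b m : ℝ} (ha : 1 ≤ a) (hl : 0 < l)
    (hb : 0 < b) (hm : 0 < m) (x : ℝ) :
    Integrable fun y => gammaPDFReal a l (x + y) * gammaPDFReal b m y := by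
  have ha0 : 0 < a := by linarith
  obtain ⟨M, hM⟩ := exists_gammaPDFReal_le_of_le (a := a) hl le_rfl (Or.inr ha)
  have hM0 : 0 ≤ M := (gammaPDFReal_nonneg ha0 hl 0).trans (hM 0 le_rfl)
  refine ((integrable_gammaPDFReal hb hm).const_mul M).mono'
    (measurable_bilateralGammaPDF_integrand a l b m x).aestronglyMeasurable
    (ae_of_all _ fun y => ?_)
  rw [Real.norm_of_nonneg (mul_nonneg (gammaPDFReal_nonneg ha0 hl _) (gammaPDFReal_nonneg hb hm _))]
  refine mul_le_mul_of_nonneg_right ?_ (gammaPDFReal_nonneg hb hm y)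
  rcases lt_or_ge (x + y) 0 with h | h
  · rwa [gammaPDFReal_of_neg h]
  · exact hM _ h

/-- The integrated recurrence needs only Fubini, not domination of a derivative that may have a
pole, so it also holds across the origin. -/
lemma intervalIntegral_bilateralGammaPDF_sub {a l b m : ℝ} (ha : 0 < a) (hl : 0 < l)
    (hb : 0 < b) (hm : 0 < m) (u v : ℝ) :
    ∫ x in u..v, l * (bilateralGammaPDF a l b m x - bilateralGammaPDF (a + 1) l b m x) =
      bilateralGammaPDF (a + 1) l b m v - bilateralGammaPDF (a + 1) l b m u := by
  have ha1 : 0 < a + 1 := by linarith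
  have h1 : ∫ x in u..v, l * (bilateralGammaPDF a l b m x - bilateralGammaPDF (a + 1) l b m x) =
      ∫ x in u..v, ∫ y,
        l * (gammaPDFReal a l (x + y) - gammaPDFReal (a + 1) l (x + y)) * gammaPDFReal b m y := by
    refine intervalIntegral.integral_congr_ae ?_
    filter_upwards [compl_mem_ae_iff.2 (measure_singleton (0 : ℝ))] with x hx _
    unfold bilateralGammaPDF
    rw [← integral_sub (integrable_bilateralGammaPDF_integrand ha hl hb hm hx)
      (integrable_bilateralGammaPDF_integrand ha1 hl hb hm hx), ← integral_const_mul]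
    refine integral_congr_ae (ae_of_all _ fun y => ?_)
    ring
  rw [h1, intervalIntegral_integral_swap]
  · unfold bilateralGammaPDF
    rw [← integral_sub
      (integrable_bilateralGammaPDF_integrand_of_one_le (by linarith) hl hb hm v)
      (integrable_bilateralGammaPDF_integrand_of_one_le (by linarith) hl hb hm u)]
    refine integral_congr_ae (ae_of_all _ fun y => ?_)
    simp only [intervalIntegral.integral_mul_const]
    rw [intervalIntegral.integral_comp_add_right
      (fun z => l * (gammaPDFReal a l z - gammaPDFReal (a + 1) l z)) y,
      integral_gammaPDFReal_sub ha hl, sub_mul]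
  · have h2 := (((integrable_prod_bilateralGammaPDF_integrand ha hl hb hm).sub
      (integrable_prod_bilateralGammaPDF_integrand ha1 hl hb hm)).const_mul l)
    refine (h2.congr (ae_of_all _ fun p => ?_)).mono_measure
      (Measure.prod_mono Measure.restrict_le_self le_rfl)
    simp only [Pi.sub_apply, Function.uncurry]
    ring

lemma hasDerivAt_bilateralGammaPDF_add_one {a l b m x : ℝ} (ha : 0 < a) (hl : 0 < l)
    (hb : 0 < b) (hm : 0 < m) (hx : ContinuousAt (bilateralGammaPDF a l b m) x) :
    HasDerivAt (bilateralGammaPDF (a + 1) l b m)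
      (l * (bilateralGammaPDF a l b m x - bilateralGammaPDF (a + 1) l b m x)) x := by
  have ha1 : 0 < a + 1 := by linarith
  have hint : Integrable fun x =>
      l * (bilateralGammaPDF a l b m x - bilateralGammaPDF (a + 1) l b m x) :=
    ((integrable_bilateralGammaPDF ha hl hb hm).sub
      (integrable_bilateralGammaPDF ha1 hl hb hm)).const_mul l
  have hc : ContinuousAt (fun x =>
      l * (bilateralGammaPDF a l b m x - bilateralGammaPDF (a + 1) l b m x)) x :=
    (hx.sub (continuous_bilateralGammaPDF ha1 hl hb hm (by linarith)).continuousAt).const_mul l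
  have h := intervalIntegral.integral_hasDerivAt_right (a := 0) hint.intervalIntegrable
    hint.aestronglyMeasurable.stronglyMeasurableAtFilter hc
  refine (h.add_const (bilateralGammaPDF (a + 1) l b m 0)).congr_of_eventuallyEq
    (Eventually.of_forall fun v => ?_)
  simp only [intervalIntegral_bilateralGammaPDF_sub ha hl hb hm, sub_add_cancel]

lemma hasDerivAt_bilateralGammaPDF {a l b m x : ℝ} (ha : 1 < a) (hl : 0 < l)
    (hb : 0 < b) (hm : 0 < m) (hx : ContinuousAt (bilateralGammaPDF (a - 1) l b m) x) :
    HasDerivAt (bilateralGammaPDF a l b m)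
      (l * (bilateralGammaPDF (a - 1) l b m x - bilateralGammaPDF a l b m x)) x := by
  simpa using hasDerivAt_bilateralGammaPDF_add_one (by linarith) hl hb hm hx

lemma bilateralGammaPDF_comp_neg (a l b m : ℝ) :
    bilateralGammaPDF a l b m = bilateralGammaPDF b m a l ∘ Neg.neg := by
  ext x
  exact (bilateralGammaPDF_neg b m a l x).symm

/-- Split `x = (x + y) - y` under the integral; each factor is absorbed by raising one shape. -/
lemma mul_bilateralGammaPDF {a l b m x : ℝ} (ha : 0 < a) (hl : 0 < l) (hb : 0 < b) (hm : 0 < m)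
    (hx : x ≠ 0) :
    x * bilateralGammaPDF a l b m x =
      a / l * bilateralGammaPDF (a + 1) l b m x - b / m * bilateralGammaPDF a l (b + 1) m x := by
  unfold bilateralGammaPDF
  rw [← integral_const_mul, ← integral_const_mul, ← integral_const_mul, ← integral_sub
    ((integrable_bilateralGammaPDF_integrand (by linarith) hl hb hm hx).const_mul _)
    ((integrable_bilateralGammaPDF_integrand ha hl (by linarith) hm hx).const_mul _)]
  refine integral_congr_ae (ae_of_all _ fun y => ?_)
  linear_combination gammaPDFReal b m y * mul_gammaPDFReal ha hl (x + y) -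
    gammaPDFReal a l (x + y) * mul_gammaPDFReal hb hm y

/-! ### Regularity off the origin and on the line. -/

/-- The bilateral Gamma density is smooth off the origin. -/
lemma contDiffOn_bilateralGammaPDF (n : ℕ) {a l b m : ℝ} (ha : 0 < a) (hl : 0 < l)
    (hb : 0 < b) (hm : 0 < m) : ContDiffOn ℝ n (bilateralGammaPDF a l b m) {x : ℝ | x ≠ 0} := by
  induction n generalizing a l b m with
  | zero =>
    exact contDiffOn_zero.2 fun x hx =>
      (continuousAt_bilateralGammaPDF_of_ne ha hl hb hm hx).continuousWithinAt
  | succ n ih =>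
    have step : ∀ {a l b m : ℝ}, 0 < a → 0 < l → 0 < b → 0 < m →
        ContDiffOn ℝ (n + 1 : ℕ) (bilateralGammaPDF (a + 1) l b m) {x : ℝ | x ≠ 0} := by
      intro a l b m ha hl hb hm
      have hd : ∀ x ∈ {x : ℝ | x ≠ 0}, HasDerivAt (bilateralGammaPDF (a + 1) l b m)
          (l * (bilateralGammaPDF a l b m x - bilateralGammaPDF (a + 1) l b m x)) x :=
        fun x hx => hasDerivAt_bilateralGammaPDF_add_one ha hl hb hm
          (continuousAt_bilateralGammaPDF_of_ne ha hl hb hm hx)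
      push_cast
      refine (contDiffOn_succ_iff_deriv_of_isOpen isOpen_ne).2
        ⟨fun x hx => (hd x hx).differentiableAt.differentiableWithinAt, by simp, ?_⟩
      refine (contDiffOn_const.mul ((ih ha hl hb hm).sub
        (ih (show 0 < a + 1 by linarith) hl hb hm))).congr fun x hx => (hd x hx).deriv
    have h2 : ContDiffOn ℝ (n + 1 : ℕ) (bilateralGammaPDF a l (b + 1) m) {x : ℝ | x ≠ 0} := by
      rw [bilateralGammaPDF_comp_neg]
      exact (step hb hm ha hl).comp contDiff_neg.contDiffOn fun x hx => neg_ne_zero.2 hx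
    have h3 : ContDiffOn ℝ (n + 1 : ℕ) (fun x : ℝ => x⁻¹) {x : ℝ | x ≠ 0} :=
      contDiffOn_id.inv fun x hx => hx
    refine (h3.mul ((contDiffOn_const (c := a / l).mul (step ha hl hb hm)).sub
      (contDiffOn_const (c := b / m).mul h2))).congr fun x hx => ?_
    rw [← mul_bilateralGammaPDF ha hl hb hm hx, inv_mul_cancel_left₀ hx]

/-- The bilateral Gamma density is of class `C^n` on the line if `n + 1 < a + b`. -/
lemma contDiff_bilateralGammaPDF (n : ℕ) {a l b m : ℝ} (ha : 0 < a) (hl : 0 < l)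
    (hb : 0 < b) (hm : 0 < m) (hn : (n : ℝ) + 1 < a + b) :
    ContDiff ℝ n (bilateralGammaPDF a l b m) := by
  induction n generalizing a l b m with
  | zero =>
    exact contDiff_zero.2 (continuous_bilateralGammaPDF ha hl hb hm (by simpa using hn))
  | succ n ih =>
    have step : ∀ {a l b m : ℝ}, 1 < a → 0 < l → 0 < b → 0 < m →
        ((n + 1 : ℕ) : ℝ) + 1 < a + b →
        ContDiff ℝ (n + 1 : ℕ) (bilateralGammaPDF a l b m) := by
      intro a l b m ha hl hb hm hn
      push_cast at hn
      have hd : ∀ x, HasDerivAt (bilateralGammaPDF a l b m)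
          (l * (bilateralGammaPDF (a - 1) l b m x - bilateralGammaPDF a l b m x)) x :=
        fun x => hasDerivAt_bilateralGammaPDF ha hl hb hm (continuous_bilateralGammaPDF
          (by linarith) hl hb hm (by linarith [n.cast_nonneg (α := ℝ)])).continuousAt
      push_cast
      refine contDiff_succ_iff_deriv.2 ⟨fun x => (hd x).differentiableAt, by simp, ?_⟩
      rw [funext fun x => (hd x).deriv]
      exact contDiff_const.mul ((ih (by linarith) hl hb hm (by linarith)).sub
        (ih (by linarith) hl hb hm (by linarith)))
    have hn0 := n.cast_nonneg (α := ℝ)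
    rcases lt_or_ge 1 a with h | h
    · exact step h hl hb hm hn
    -- Here `a ≤ 1` forces `1 < b`, so the reflected density can be lowered instead.
    · rw [bilateralGammaPDF_comp_neg]
      refine (step ?_ hm ha hl (by linarith)).comp contDiff_neg
      push_cast at hn
      linarith

/-! ### Failure of regularity at the origin. -/

/-- The bilateral Gamma density has at least a logarithmic pole at the origin if `a + b ≤ 1`. -/
lemma exists_mul_neg_log_le_bilateralGammaPDF {a l b m : ℝ} (ha : 0 < a) (hl : 0 < l)
    (hb : 0 < b) (hm : 0 < m) (hs : a + b ≤ 1) :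
    ∃ c > 0, ∀ x ∈ Ioo (0 : ℝ) 1, c * -Real.log x ≤ bilateralGammaPDF a l b m x := by
  have hΓa := Real.Gamma_pos_of_pos ha
  have hΓb := Real.Gamma_pos_of_pos hb
  -- For `x ≤ y ≤ 1` one has `x + y ≤ 2 * y ≤ 2`; the constant collects the resulting lower bounds
  -- of both factors, leaving `y ^ (a + b - 2) ≥ y⁻¹` to integrate over `[x, 1]`.
  refine ⟨l ^ a / Real.Gamma a * 2 ^ (a - 1) * Real.exp (-(l * 2)) *
    (m ^ b / Real.Gamma b * Real.exp (-(m * 1))), by positivity, ?_⟩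
  set c := l ^ a / Real.Gamma a * 2 ^ (a - 1) * Real.exp (-(l * 2)) *
    (m ^ b / Real.Gamma b * Real.exp (-(m * 1))) with hc
  rintro x ⟨hx0, hx1⟩
  have hint := integrable_bilateralGammaPDF_integrand ha hl hb hm hx0.ne'
  have hnn : ∀ y, 0 ≤ gammaPDFReal a l (x + y) * gammaPDFReal b m y := fun y =>
    mul_nonneg (gammaPDFReal_nonneg ha hl _) (gammaPDFReal_nonneg hb hm _)
  have h1 : ∫ y in x..1, c * y⁻¹ = c * -Real.log x := by
    rw [intervalIntegral.integral_const_mul, integral_inv_of_pos hx0 one_pos, one_div,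
      Real.log_inv]
  have hpt : ∀ y ∈ Icc x 1, c * y⁻¹ ≤ gammaPDFReal a l (x + y) * gammaPDFReal b m y := by
    rintro y ⟨hxy, hy1⟩
    have hy0 : 0 < y := hx0.trans_le hxy
    have e1 : l ^ a / Real.Gamma a * 2 ^ (a - 1) * Real.exp (-(l * 2)) * y ^ (a - 1) ≤
        gammaPDFReal a l (x + y) := by
      have h2 : gammaPDFReal a l (2 * y) ≤ gammaPDFReal a l (x + y) :=
        gammaPDFReal_antitoneOn ha hl (by linarith) (mem_Ioi.2 (by linarith))
          (mem_Ioi.2 (by linarith)) (by linarith)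
      refine le_trans ?_ h2
      rw [gammaPDFReal_of_nonneg (by linarith), Real.mul_rpow zero_le_two hy0.le]
      have h3 : Real.exp (-(l * 2)) ≤ Real.exp (-(l * (2 * y))) :=
        Real.exp_le_exp.2 (by nlinarith)
      calc _ = l ^ a / Real.Gamma a * (2 ^ (a - 1) * y ^ (a - 1)) * Real.exp (-(l * 2)) := by ring
        _ ≤ _ := mul_le_mul_of_nonneg_left h3 (by positivity)
    have e2 : m ^ b / Real.Gamma b * Real.exp (-(m * 1)) * y ^ (b - 1) ≤ gammaPDFReal b m y := by
      rw [gammaPDFReal_of_nonneg hy0.le]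
      have h3 : Real.exp (-(m * 1)) ≤ Real.exp (-(m * y)) :=
        Real.exp_le_exp.2 (by nlinarith)
      calc _ = m ^ b / Real.Gamma b * y ^ (b - 1) * Real.exp (-(m * 1)) := by ring
        _ ≤ _ := mul_le_mul_of_nonneg_left h3 (by positivity)
    have e3 : y⁻¹ ≤ y ^ (a - 1) * y ^ (b - 1) := by
      rw [← Real.rpow_add hy0, ← Real.rpow_neg_one]
      exact Real.rpow_le_rpow_of_exponent_ge hy0 hy1 (by linarith)
    calc c * y⁻¹ ≤ c * (y ^ (a - 1) * y ^ (b - 1)) :=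
          mul_le_mul_of_nonneg_left e3 (by positivity)
      _ = (l ^ a / Real.Gamma a * 2 ^ (a - 1) * Real.exp (-(l * 2)) * y ^ (a - 1)) *
          (m ^ b / Real.Gamma b * Real.exp (-(m * 1)) * y ^ (b - 1)) := by rw [hc]; ring
      _ ≤ _ := mul_le_mul e1 e2 (by positivity) (gammaPDFReal_nonneg ha hl _)
  have h2 : ∫ y in x..1, c * y⁻¹ ≤
      ∫ y in x..1, gammaPDFReal a l (x + y) * gammaPDFReal b m y := by
    refine intervalIntegral.integral_mono_on hx1.le ?_ hint.intervalIntegrable hpt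
    refine (intervalIntegral.intervalIntegrable_inv (fun y hy => ?_) continuousOn_id).const_mul c
    rw [uIcc_of_le hx1.le] at hy
    exact (hx0.trans_le hy.1).ne'
  rw [← h1]
  refine h2.trans ?_
  rw [intervalIntegral.integral_of_le hx1.le]
  exact setIntegral_le_integral hint (ae_of_all _ hnn)

lemma not_continuousAt_of_eq_bilateralGammaPDF {a l b m : ℝ} (ha : 0 < a) (hl : 0 < l)
    (hb : 0 < b) (hm : 0 < m) (hs : a + b ≤ 1) {g : ℝ → ℝ}
    (hg : ∀ x ≠ 0, g x = bilateralGammaPDF a l b m x) : ¬ ContinuousAt g 0 := by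
  intro h
  obtain ⟨c, hc, hle⟩ := exists_mul_neg_log_le_bilateralGammaPDF ha hl hb hm hs
  have h1 : Tendsto (fun x => c * -Real.log x) (𝓝[>] 0) atTop :=
    (tendsto_neg_atBot_atTop.comp Real.tendsto_log_nhdsGT_zero).const_mul_atTop hc
  have h2 : Tendsto g (𝓝[>] 0) atTop := by
    refine tendsto_atTop_mono' _ ?_ h1
    filter_upwards [Ioo_mem_nhdsGT (zero_lt_one' ℝ)] with x hx
    rw [hg x hx.1.ne']
    exact hle x hx
  exact not_tendsto_nhds_of_tendsto_atTop h2 _ (h.tendsto.mono_left nhdsWithin_le_nhds)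

lemma bilateralGammaPDF_zero_pos {a l b m : ℝ} (ha : 0 < a) (hl : 0 < l)
    (hb : 0 < b) (hm : 0 < m) (hs : 1 < a + b) : 0 < bilateralGammaPDF a l b m 0 := by
  unfold bilateralGammaPDF
  simp only [zero_add]
  rw [integral_pos_iff_support_of_nonneg (fun y => mul_nonneg (gammaPDFReal_nonneg ha hl _)
    (gammaPDFReal_nonneg hb hm _)) (integrable_gammaPDFReal_mul hl hm hs)]
  have : Ioi (0 : ℝ) ⊆ Function.support fun y => gammaPDFReal a l y * gammaPDFReal b m y :=
    fun y hy => (mul_pos (gammaPDFReal_pos ha hl hy) (gammaPDFReal_pos hb hm hy)).ne'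
  refine lt_of_lt_of_le ?_ (measure_mono this)
  simp

/-- As `a ≤ 1`, replacing `(x + y) ^ (a - 1)` by `y ^ (a - 1)` only increases the integrand, and
`exp (-(l * x))` factors out. -/
lemma bilateralGammaPDF_le_exp_mul {a l b m x : ℝ} (ha : 0 < a) (hl : 0 < l)
    (hb : 0 < b) (hm : 0 < m) (hs : 1 < a + b) (ha1 : a ≤ 1) (hx : 0 < x) :
    bilateralGammaPDF a l b m x ≤ Real.exp (-(l * x)) * bilateralGammaPDF a l b m 0 := by
  unfold bilateralGammaPDF
  simp only [zero_add]
  rw [← integral_const_mul]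
  refine integral_mono_ae (integrable_bilateralGammaPDF_integrand ha hl hb hm hx.ne')
    ((integrable_gammaPDFReal_mul hl hm hs).const_mul _) ?_
  filter_upwards [compl_mem_ae_iff.2 (measure_singleton (0 : ℝ))] with y hy
  rcases lt_or_gt_of_ne hy with h | h
  · simp [gammaPDFReal_of_neg h]
  · rw [← mul_assoc]
    refine mul_le_mul_of_nonneg_right ?_ (gammaPDFReal_nonneg hb hm y)
    rw [gammaPDFReal_of_nonneg (by linarith), gammaPDFReal_of_nonneg h.le]
    have h1 : (x + y) ^ (a - 1) ≤ y ^ (a - 1) :=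
      Real.rpow_le_rpow_of_nonpos h (by linarith) (by linarith)
    have h2 : Real.exp (-(l * (x + y))) = Real.exp (-(l * x)) * Real.exp (-(l * y)) := by
      rw [← Real.exp_add]; ring_nf
    have hΓa := Real.Gamma_pos_of_pos ha
    calc _ = l ^ a / Real.Gamma a * Real.exp (-(l * (x + y))) * (x + y) ^ (a - 1) := by ring
      _ ≤ l ^ a / Real.Gamma a * Real.exp (-(l * (x + y))) * y ^ (a - 1) :=
        mul_le_mul_of_nonneg_left h1 (by positivity)
      _ = _ := by rw [h2]; ring

/-- The exponential majorant touches the density at `0`, so right difference quotients compare. -/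
lemma deriv_le_of_hasDerivAt_bilateralGammaPDF_zero {a l b m d : ℝ} (ha : 0 < a) (hl : 0 < l)
    (hb : 0 < b) (hm : 0 < m) (hs : 1 < a + b) (ha1 : a ≤ 1)
    (hd : HasDerivAt (bilateralGammaPDF a l b m) d 0) :
    d ≤ -l * bilateralGammaPDF a l b m 0 := by
  have h1 : HasDerivAt (fun x => Real.exp (-(l * x)) * bilateralGammaPDF a l b m 0)
      (Real.exp (-(l * 0)) * (-(l * 1)) * bilateralGammaPDF a l b m 0) 0 :=
    (((hasDerivAt_id (0 : ℝ)).const_mul l).neg.exp).mul_const _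
  have h2 := (h1.sub hd).tendsto_slope_zero_right
  have h3 := ge_of_tendsto (b := 0) h2 (by
    filter_upwards [self_mem_nhdsWithin] with t ht
    have := bilateralGammaPDF_le_exp_mul ha hl hb hm hs ha1 (mem_Ioi.1 ht)
    have ht' : 0 < t⁻¹ := inv_pos.2 ht
    simp only [Pi.sub_apply, zero_add, smul_eq_mul, mul_zero, neg_zero, Real.exp_zero, one_mul,
      sub_self, sub_zero]
    exact mul_nonneg ht'.le (by linarith))
  simp only [mul_zero, neg_zero, Real.exp_zero, one_mul, mul_one] at h3
  linarith

lemma not_differentiableAt_bilateralGammaPDF_zero {a l b m : ℝ} (ha : 0 < a) (hl : 0 < l)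
    (hb : 0 < b) (hm : 0 < m) (hs : 1 < a + b) (ha1 : a ≤ 1) (hb1 : b ≤ 1) :
    ¬ DifferentiableAt ℝ (bilateralGammaPDF a l b m) 0 := by
  intro h
  have h1 := deriv_le_of_hasDerivAt_bilateralGammaPDF_zero ha hl hb hm hs ha1 h.hasDerivAt
  have h2 : HasDerivAt (bilateralGammaPDF b m a l)
      (deriv (bilateralGammaPDF a l b m) 0 * -1) 0 := by
    rw [bilateralGammaPDF_comp_neg]
    refine HasDerivAt.comp 0 ?_ (hasDerivAt_neg 0)
    rw [neg_zero]
    exact h.hasDerivAt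
  have h3 := deriv_le_of_hasDerivAt_bilateralGammaPDF_zero hb hm ha hl (by linarith) hb1 h2
  have h4 := bilateralGammaPDF_neg a l b m 0
  rw [neg_zero] at h4
  have h5 := bilateralGammaPDF_zero_pos ha hl hb hm hs
  rw [← h4] at h3
  nlinarith

/-- No function agreeing with the bilateral Gamma density off the origin is of class `C^n` if
`n < a + b ≤ n + 1`. -/
lemma not_contDiff_of_eq_bilateralGammaPDF (n : ℕ) {a l b m : ℝ} (ha : 0 < a) (hl : 0 < l)
    (hb : 0 < b) (hm : 0 < m) (hn₁ : (n : ℝ) < a + b) (hn₂ : a + b ≤ n + 1) {g : ℝ → ℝ}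
    (hg : ∀ x ≠ 0, g x = bilateralGammaPDF a l b m x) : ¬ ContDiff ℝ n g := by
  induction n generalizing a l b m g with
  | zero =>
    exact fun h => not_continuousAt_of_eq_bilateralGammaPDF ha hl hb hm (by simpa using hn₂) hg
      h.continuous.continuousAt
  | succ n ih =>
    have step : ∀ {a l b m : ℝ}, 1 < a → 0 < l → 0 < b → 0 < m →
        ((n + 1 : ℕ) : ℝ) < a + b → a + b ≤ ((n + 1 : ℕ) : ℝ) + 1 → ∀ {g : ℝ → ℝ},
        (∀ x ≠ 0, g x = bilateralGammaPDF a l b m x) → ¬ ContDiff ℝ (n + 1 : ℕ) g := by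
      intro a l b m ha hl hb hm hn₁ hn₂ g hg h
      push_cast at hn₁ hn₂ h
      -- This combination is the density of shape `a - 1` off the origin; its value at `0` is not
      -- controlled, which is why the induction runs over all `g` agreeing only there.
      have hd : ContDiff ℝ n fun x => g x + l⁻¹ * deriv g x :=
        (h.of_le (by exact_mod_cast n.le_succ)).add
          (contDiff_const.mul (contDiff_succ_iff_deriv.1 h).2.2)
      refine ih (a := a - 1) (l := l) (b := b) (m := m) (by linarith) hl hb hm
        (by linarith) (by linarith) (fun x hx => ?_) hd
      have h1 : g =ᶠ[𝓝 x] bilateralGammaPDF a l b m := by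
        filter_upwards [isOpen_ne.mem_nhds hx] with y hy using hg y hy
      have h2 := (hasDerivAt_bilateralGammaPDF ha hl hb hm
        (continuousAt_bilateralGammaPDF_of_ne (by linarith) hl hb hm hx)).deriv
      rw [h1.deriv_eq, h2, hg x hx, inv_mul_cancel_left₀ hl.ne']
      ring
    rcases lt_or_ge 1 a with ha1 | ha1
    · exact step ha1 hl hb hm hn₁ hn₂ hg
    rcases lt_or_ge 1 b with hb1 | hb1
    · intro h
      refine step hb1 hm ha hl (by linarith) (by linarith) (g := g ∘ Neg.neg) (fun x hx => ?_)
        (h.comp contDiff_neg)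
      rw [Function.comp_apply, hg _ (neg_ne_zero.2 hx), bilateralGammaPDF_neg]
    · intro h
      -- Both shapes are now at most `1`, so neither can be lowered; continuity at `0` identifies
      -- `g` with the density everywhere.
      have hs : 1 < a + b := by
        push_cast at hn₁
        linarith [n.cast_nonneg (α := ℝ)]
      have heq : g = bilateralGammaPDF a l b m :=
        Continuous.ext_on (dense_compl_singleton (0 : ℝ)) h.continuous
          (continuous_bilateralGammaPDF ha hl hb hm hs) fun x hx => hg x hx
      rw [heq] at h
      exact not_differentiableAt_bilateralGammaPDF_zero ha hl hb hm hs ha1 hb1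
        (h.differentiable (by simp) 0)

/-! ### Identification of the law and of continuous versions. -/

lemma measurable_gammaPDF (a r : ℝ) : Measurable (gammaPDF a r) :=
  (measurable_gammaPDFReal a r).ennreal_ofReal

lemma lintegral_gammaPDF_mul_eq_ofReal_bilateralGammaPDF {a l b m x : ℝ} (ha : 0 < a)
    (hl : 0 < l) (hb : 0 < b) (hm : 0 < m) (hx : x ≠ 0) :
    ∫⁻ y, gammaPDF a l (x + y) * gammaPDF b m y = ENNReal.ofReal (bilateralGammaPDF a l b m x) := by
  unfold bilateralGammaPDF
  rw [ofReal_integral_eq_lintegral_ofReal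
    (integrable_bilateralGammaPDF_integrand ha hl hb hm hx)
    (ae_of_all _ fun y => mul_nonneg (gammaPDFReal_nonneg ha hl _) (gammaPDFReal_nonneg hb hm _))]
  refine lintegral_congr fun y => ?_
  rw [ENNReal.ofReal_mul (gammaPDFReal_nonneg ha hl _)]
  rfl

lemma isBilateralGammaDensity_bilateralGammaPDF {a l b m : ℝ} (ha : 0 < a) (hl : 0 < l)
    (hb : 0 < b) (hm : 0 < m) :
    IsBilateralGammaDensity a l b m (bilateralGammaPDF a l b m) := by
  refine ⟨measurable_bilateralGammaPDF a l b m, bilateralGammaPDF_nonneg ha hl hb hm, ?_⟩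
  have hma := measurable_gammaPDF a l
  have hmb := measurable_gammaPDF b m
  have hmf := (measurable_bilateralGammaPDF a l b m).ennreal_ofReal
  refine Measure.ext_of_lintegral _ fun φ hφ => ?_
  unfold bilateralGammaMeasure gammaMeasure
  rw [lintegral_map hφ (by fun_prop), prod_withDensity hma hmb,
    lintegral_withDensity_eq_lintegral_mul _ (by fun_prop) (by fun_prop),
    lintegral_withDensity_eq_lintegral_mul _ hmf hφ, lintegral_prod_symm _ (by fun_prop)]
  calc ∫⁻ y, ∫⁻ x, gammaPDF a l x * gammaPDF b m y * φ (x - y)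
      = ∫⁻ y, ∫⁻ x, gammaPDF a l (x + y) * gammaPDF b m y * φ x := by
        refine lintegral_congr fun y => ?_
        rw [← lintegral_add_right_eq_self _ y]
        simp only [add_sub_cancel_right]
    _ = ∫⁻ x, ∫⁻ y, gammaPDF a l (x + y) * gammaPDF b m y * φ x :=
        lintegral_lintegral_swap (by fun_prop)
    _ = ∫⁻ x, ENNReal.ofReal (bilateralGammaPDF a l b m x) * φ x := by
        refine lintegral_congr_ae ?_
        filter_upwards [compl_mem_ae_iff.2 (measure_singleton (0 : ℝ))] with x hx
        rw [lintegral_mul_const _ (by fun_prop),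
          lintegral_gammaPDF_mul_eq_ofReal_bilateralGammaPDF ha hl hb hm hx]

/-- A continuous version of the bilateral Gamma density agrees with it off the origin. -/
lemma IsBilateralGammaDensity.eq_bilateralGammaPDF {a l b m : ℝ} (ha : 0 < a) (hl : 0 < l)
    (hb : 0 < b) (hm : 0 < m) {g : ℝ → ℝ} (hg : IsBilateralGammaDensity a l b m g)
    (hgc : Continuous g) {x : ℝ} (hx : x ≠ 0) : g x = bilateralGammaPDF a l b m x := by
  obtain ⟨hfm, hf0, hf⟩ := isBilateralGammaDensity_bilateralGammaPDF ha hl hb hm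
  obtain ⟨hgm, hg0, hg⟩ := hg
  have hae := (withDensity_eq_iff_of_sigmaFinite hgm.ennreal_ofReal.aemeasurable
    hfm.ennreal_ofReal.aemeasurable).1 (hg.symm.trans hf)
  have hae' : g =ᵐ[volume] bilateralGammaPDF a l b m := by
    filter_upwards [hae] with y hy
    exact (ENNReal.ofReal_eq_ofReal_iff (hg0 y) (hf0 y)).1 hy
  exact Measure.eqOn_open_of_ae_eq (ae_restrict_of_ae hae') isOpen_ne hgc.continuousOn
    (fun y hy => (continuousAt_bilateralGammaPDF_of_ne ha hl hb hm hy).continuousWithinAt) hx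

/-- Quantifying over `m` with `m + 1 = N` avoids truncated subtraction and is vacuous for `N = 0`.
-/
theorem theorem4p1 (ap lp am lm : ℝ) (hap : 0 < ap) (hlp : 0 < lp) (ham : 0 < am) (hlm : 0 < lm)
    (N : ℕ) (hN₁ : (N : ℝ) < ap + am) (hN₂ : ap + am ≤ (N : ℝ) + 1) :
    IsBilateralGammaDensity ap lp am lm (bilateralGammaPDF ap lp am lm) ∧
    ContDiffOn ℝ N (bilateralGammaPDF ap lp am lm) {x : ℝ | x ≠ 0} ∧
    (∀ m : ℕ, m + 1 = N → ContDiff ℝ m (bilateralGammaPDF ap lp am lm)) ∧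
    ¬ ContDiff ℝ N (bilateralGammaPDF ap lp am lm) ∧
    (∀ g : ℝ → ℝ, IsBilateralGammaDensity ap lp am lm g → ¬ ContDiff ℝ N g) := by
  refine ⟨isBilateralGammaDensity_bilateralGammaPDF hap hlp ham hlm,
    contDiffOn_bilateralGammaPDF N hap hlp ham hlm, ?_,
    not_contDiff_of_eq_bilateralGammaPDF N hap hlp ham hlm hN₁ hN₂ fun _ _ => rfl, ?_⟩
  · rintro m rfl
    exact contDiff_bilateralGammaPDF m hap hlp ham hlm (by exact_mod_cast hN₁)
  · intro g hg h
    exact not_contDiff_of_eq_bilateralGammaPDF N hap hlp ham hlm hN₁ hN₂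
      (fun x hx => hg.eq_bilateralGammaPDF hap hlp ham hlm h.continuous hx) h
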